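/- Let $d,N\ge 0$ be integers. Let $\widehat D=\{x\in\mathbb R^d : x_i\ge -1 \ (1\le i\le d),\ x_1+\dots+x_d\le 2-d\}$ be the reference simplex, with barycentric coordinates $\lambda_i=\frac{1+x_i}{2}$ for $1\le i\le d$ and $\lambda_0=1-\lambda_1-\dots-\lambda_d$ (for $d=3$: $\widehat D=\{r,s,t\ge -1,\ r+s+t\le -1\}$). For a multi-index $\alpha=(\alpha_0,\dots,\alpha_d)\in\mathbb N^{d+1}$ with $|\alpha|=\alpha_0+\dots+\alpha_d=N$, let $$B^N_\alpha=\frac{N!}{\alpha_0!\cdots\alpha_d!}\,\lambda_0^{\alpha_0}\cdots\lambda_d^{\alpha_d}$$ be the Bernstein polynomials of degree $N$, and let $M_N$ be the Bernstein mass matrix, $(M_N)_{\alpha\beta}=\int_{\widehat D}B^N_\alpha B^N_\beta\,dx$ for $|\alpha|=|\beta|=N$. For $n\ge 1$ let $E^n_{n-1}$ be the one-degree elevation matrix, with rows indexed by $|\beta|=n$ and columns by $|\alpha|=n-1$, whose entry at $(\beta,\alpha)$ is $\frac{\alpha_j+1}{n}$ if $\beta=\alpha+e_j$ for some $j\in\{0,\dots,d\}$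 and $0$ otherwise; equivalently $B^{n-1}_\alpha=\sum_{|\beta|=n}(E^n_{n-1})_{\beta\alpha}B^n_\beta$. For $0\le i\le N$ let $E^N_{N-i}=E^N_{N-1}E^{N-1}_{N-2}\cdots E^{N-i+1}_{N-i}$ be the degree elevation matrix from degree $N-i$ to degree $N$ (with $E^N_N=I$). Then $M_N$ is invertible, and there exist real numbers $c_0,\dots,c_N$ (depending only on $d$ and $N$) such that $$M_N^{-1}=\sum_{j=0}^{N}c_j\,E^N_{N-j}\bigl(E^N_{N-j}\bigr)^T.$$ -/

import Mathlib

open scoped Matrix Nat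

noncomputable section

namespace BernsteinMass

/-- Multi-indices `α = (α₀, …, α_d)` of order `|α| = N`. -/
abbrev MultiIndex (d N : ℕ) : Type := {α : Fin (d + 1) → ℕ // ∑ j, α j = N}

instance instFintypeMultiIndex (d N : ℕ) : Fintype (MultiIndex d N) :=
  Fintype.subtype (Finset.Nat.antidiagonalTuple (d + 1) N)
    (fun _ => Finset.Nat.mem_antidiagonalTuple)

/-- The reference simplex `{x ∈ ℝ^d : x_i ≥ -1, x_1 + ⋯ + x_d ≤ 2 - d}`; for `d = 3` it is the
tetrahedron `r, s, t ≥ -1`, `r + s + t ≤ -1`. -/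
def refSimplex (d : ℕ) : Set (Fin d → ℝ) :=
  {x | (∀ i, -1 ≤ x i) ∧ ∑ i, x i ≤ 2 - (d : ℝ)}

/-- Barycentric coordinates on the reference simplex: `λ_i = (1 + x_i) / 2` for `1 ≤ i ≤ d` and
`λ_0 = (2 - d - (x_1 + ⋯ + x_d)) / 2`, which for `d = 3` is `-(1 + r + s + t) / 2`. -/
def bary (d : ℕ) (x : Fin d → ℝ) : Fin (d + 1) → ℝ :=
  Fin.cons ((2 - (d : ℝ) - ∑ i, x i) / 2) (fun i => (1 + x i) / 2)

/-- The Bernstein polynomial `B^N_α = N! / (α₀! ⋯ α_d!) λ₀^α₀ ⋯ λ_d^α_d`. -/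
def bernstein (d N : ℕ) (α : MultiIndex d N) (x : Fin d → ℝ) : ℝ :=
  ((N ! : ℝ) / ∏ j, ((α.1 j)! : ℝ)) * ∏ j, bary d x j ^ α.1 j

/-- The Bernstein mass matrix of degree `N` on the reference simplex. -/
def massMatrix (d N : ℕ) : Matrix (MultiIndex d N) (MultiIndex d N) ℝ :=
  Matrix.of fun α β => ∫ x in refSimplex d, bernstein d N α x * bernstein d N β x

/-- The one-degree elevation matrix `E^n_{n-1}`. Its column `α` (`|α| = n - 1`) holds the
coefficients of `B^{n-1}_α` in the Bernstein basis of degree `n`: the entry in row `α + e_j` is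
`(α_j + 1) / n`, for `j = 0, …, d`, and all other entries vanish. -/
def elevationStep (d n : ℕ) : Matrix (MultiIndex d n) (MultiIndex d (n - 1)) ℝ :=
  Matrix.of fun β α =>
    ∑ j, if β.1 = α.1 + Pi.single j 1 then ((α.1 j : ℝ) + 1) / (n : ℝ) else 0

/-- The degree elevation matrix `E^N_{N-i} = E^N_{N-1} E^{N-1}_{N-2} ⋯ E^{N-i+1}_{N-i}`,
for `i ≤ N`. -/
def elevation (d N : ℕ) : (i : ℕ) → Matrix (MultiIndex d N) (MultiIndex d (N - i)) ℝ
  | 0 => (1 : Matrix (MultiIndex d N) (MultiIndex d N) ℝ)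
  | i + 1 => elevation d N i * elevationStep d (N - i)

theorem sum_bary (d : ℕ) (x : Fin d → ℝ) : ∑ j, bary d x j = 1 := by
  rw [Fin.sum_univ_succ]
  simp only [bary, Fin.cons_zero, Fin.cons_succ]
  rw [← Finset.sum_div, Finset.sum_add_distrib]
  simp
  ring

theorem bernstein_eq_sum_elevationStep (d n : ℕ) (hn : 1 ≤ n) (α : MultiIndex d (n - 1))
    (x : Fin d → ℝ) :
    bernstein d (n - 1) α x = ∑ β, elevationStep d n β α * bernstein d n β x := by
  obtain ⟨m, rfl⟩ : ∃ m, n = m + 1 := ⟨n - 1, by omega⟩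
  change bernstein d m α x = _
  have hα : ∑ j, α.1 j = m := α.2
  have hsum : ∀ j, ∑ k, (α.1 + Pi.single j 1 : Fin (d + 1) → ℕ) k = m + 1 := by
    intro j
    simp [Finset.sum_add_distrib, hα]
  have key : ∀ j, ∑ β : MultiIndex d (m + 1),
      (if β.1 = α.1 + Pi.single j 1 then ((α.1 j : ℝ) + 1) / ((m + 1 : ℕ) : ℝ) else 0)
        * bernstein d (m + 1) β x = bary d x j * bernstein d m α x := by
    intro j
    rw [Finset.sum_eq_single (⟨(α.1 + Pi.single j 1 : Fin (d + 1) → ℕ), hsum j⟩ : MultiIndex d (m + 1))]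
    · have h1 : ∏ k, (((α.1 + Pi.single j 1 : Fin (d + 1) → ℕ) k)! : ℝ)
          = ((α.1 j : ℝ) + 1) * ∏ k, ((α.1 k)! : ℝ) := by
        rw [← Finset.mul_prod_erase _ _ (Finset.mem_univ j),
          ← Finset.mul_prod_erase Finset.univ (fun k => ((α.1 k)! : ℝ)) (Finset.mem_univ j),
          ← mul_assoc]
        congr 1
        · simp [Nat.factorial_succ]
        · refine Finset.prod_congr rfl fun k hk => ?_
          simp [Finset.ne_of_mem_erase hk]
      have h2 : ∏ k, bary d x k ^ (α.1 + Pi.single j 1 : Fin (d + 1) → ℕ) k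
          = bary d x j * ∏ k, bary d x k ^ α.1 k := by
        simp only [Pi.add_apply, pow_add, Finset.prod_mul_distrib]
        rw [mul_comm]
        congr 1
        rw [Finset.prod_eq_single j] <;> simp +contextual
      have h3 : (∏ k, ((α.1 k)! : ℝ)) ≠ 0 :=
        Finset.prod_ne_zero_iff.2 fun k _ => by positivity
      have h4 : ((α.1 j : ℝ) + 1) ≠ 0 := by positivity
      have h5 : ((m : ℝ) + 1) ≠ 0 := by positivity
      simp only [bernstein, h1, h2, if_true, Nat.factorial_succ]
      push_cast
      field_simp
    · intro β _ hβ
      rw [if_neg, zero_mul]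
      exact fun h => hβ (Subtype.ext h)
    · simp
  simp only [elevationStep, Matrix.of_apply, Finset.sum_mul]
  rw [Finset.sum_comm, Finset.sum_congr rfl fun j _ => key j, ← Finset.sum_mul]
  have h := sum_bary d x
  rw [h, one_mul]

/-- `elevation d N i` does represent a polynomial of degree `N - i` in degree `N`: its column `α`
holds the Bernstein coefficients of degree `N` of `B^{N-i}_α`. -/
theorem bernstein_eq_sum_elevation (d N i : ℕ) (hi : i ≤ N) (α : MultiIndex d (N - i))
    (x : Fin d → ℝ) :
    bernstein d (N - i) α x = ∑ β, elevation d N i β α * bernstein d N β x := by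
  induction i with
  | zero =>
    change bernstein d N α x = ∑ β, (1 : Matrix (MultiIndex d N) (MultiIndex d N) ℝ) β α * _
    simp [Matrix.one_apply]
  | succ i ih =>
    have h := bernstein_eq_sum_elevationStep d (N - i) (by omega) α x
    refine h.trans ?_
    simp only [fun γ => ih (by omega) γ, elevation, Matrix.mul_apply, Finset.mul_sum,
      Finset.sum_mul]
    rw [Finset.sum_comm]
    refine Finset.sum_congr rfl fun β _ => Finset.sum_congr rfl fun γ _ => ?_
    ring

end BernsteinMass

end

open scoped Matrix Nat

noncomputable section

namespace BernsteinMass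

open MeasureTheory
open scoped ENNReal

variable {d : ℕ}

/-! Write G_j = E^N_{N-j} (E^N_{N-j})ᵀ. The proof shows that G_0, …, G_N span exactly the algebra
ℝ[G_1], and that M_N is an invertible element of it. A finite-dimensional matrix algebra contains
the inverses of its invertible elements, so M_N⁻¹ is a combination of the G_j.

The algebra comes from a ladder relation (`elevationStep_transpose_mul_self`): EᵀE at degree n + 1
equals a multiple of EEᵀ at degree n plus a scalar. Moving G_1 through the elevations gives G_1 G_j
= p G_{j+1} + q G_j, with p ≠ 0 for j < N and G_{N+1} = 0.

Membership of M_N comes from Dirichlet's integral: its entries are a constant times ∏ C(α_k + β_k,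
α_k). Vandermonde's identity splits this into sums of ∏ C(α_k, γ_k) C(β_k, γ_k), and the entries of
E^N_{N-j} are such binomial products up to a scalar. So M_N is a positive combination of the G_j,
and it is positive definite since G_0 = 1. -/

/-! ### Entries of the elevation matrices -/

theorem sum_add_single (α : Fin (d + 1) → ℕ) (j : Fin (d + 1)) :
    ∑ k, (α + Pi.single j 1 : Fin (d + 1) → ℕ) k = ∑ k, α k + 1 := by
  simp [Finset.sum_add_distrib]

/-- Truncated subtraction makes this a map from degree 0 to degree 0. Its vanishing ends the
recursion at G_{N+1} = 0. -/
theorem elevationStep_zero (d : ℕ) : elevationStep d 0 = 0 := by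
  ext β α
  simp [elevationStep]

/-- Summing against a column of the elevation matrix. -/
theorem sum_mul_elevationStep {n : ℕ} (hn : 1 ≤ n) (f : (Fin (d + 1) → ℕ) → ℝ)
    (α : MultiIndex d (n - 1)) :
    ∑ γ : MultiIndex d n, f γ.1 * elevationStep d n γ α =
      ∑ j, f (α.1 + Pi.single j 1) * (((α.1 j : ℝ) + 1) / n) := by
  simp only [elevationStep, Matrix.of_apply, Finset.mul_sum]
  rw [Finset.sum_comm]
  refine Finset.sum_congr rfl fun j _ => ?_
  have hs : ∑ k, (α.1 + Pi.single j 1 : Fin (d + 1) → ℕ) k = n := by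
    rw [sum_add_single, α.2]; omega
  rw [Finset.sum_eq_single (⟨_, hs⟩ : MultiIndex d n)]
  · simp
  · intro β _ hβ
    rw [if_neg, mul_zero]
    exact fun h => hβ (Subtype.ext h)
  · simp

theorem prod_choose_add_single (α β : Fin (d + 1) → ℕ) (j : Fin (d + 1)) :
    (∏ k, ((β k).choose ((α + Pi.single j 1 : Fin (d + 1) → ℕ) k) : ℝ)) * ((α j : ℝ) + 1) =
      (∏ k, ((β k).choose (α k) : ℝ)) * ((β j : ℝ) - α j) := by
  have h1 : ∏ k ∈ Finset.univ.erase j, ((β k).choose ((α + Pi.single j 1 : Fin (d + 1) → ℕ) k) : ℝ)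
      = ∏ k ∈ Finset.univ.erase j, ((β k).choose (α k) : ℝ) :=
    Finset.prod_congr rfl fun k hk => by simp [Finset.ne_of_mem_erase hk]
  have h2 : ((β j).choose (α j + 1) : ℝ) * ((α j : ℝ) + 1) =
      ((β j).choose (α j) : ℝ) * ((β j : ℝ) - α j) := by
    rcases le_or_gt (α j) (β j) with h | h
    · rw [← Nat.cast_sub h]
      exact_mod_cast Nat.choose_succ_right_eq (β j) (α j)
    · simp [Nat.choose_eq_zero_of_lt h, Nat.choose_eq_zero_of_lt (Nat.lt_succ_of_lt h)]
  rw [← Finset.mul_prod_erase _ _ (Finset.mem_univ j), h1,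
    ← Finset.mul_prod_erase Finset.univ (fun k => ((β k).choose (α k) : ℝ)) (Finset.mem_univ j)]
  simp only [Pi.add_apply, Pi.single_eq_same]
  linear_combination (∏ k ∈ Finset.univ.erase j, ((β k).choose (α k) : ℝ)) * h2

/-- The entries of the degree elevation matrix in closed form. -/
theorem elevation_apply (N i : ℕ) (hi : i ≤ N) (β : MultiIndex d N) (α : MultiIndex d (N - i)) :
    elevation d N i β α = (∏ k, ((β.1 k).choose (α.1 k) : ℝ)) / N.choose (N - i) := by
  induction i with
  | zero =>
    have hα : ∑ k, α.1 k = N := α.2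
    change (1 : Matrix (MultiIndex d N) (MultiIndex d N) ℝ) β α = _
    by_cases h : β.1 = α.1
    · have : β = α := Subtype.ext h
      subst this
      simp
    · have h' : β ≠ α := fun e => h (congrArg Subtype.val e)
      rw [Matrix.one_apply_ne h']
      -- Distinct multi-indices of equal order cannot be comparable, so some binomial factor
      -- vanishes.
      obtain ⟨k, hk⟩ : ∃ k, β.1 k < α.1 k := by
        by_contra! hle
        refine h (funext fun k => ?_)
        have := (Finset.sum_eq_sum_iff_of_le (s := Finset.univ) fun k _ => hle k).1
          (hα.trans β.2.symm) k (Finset.mem_univ k)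
        exact this.symm
      rw [Finset.prod_eq_zero (Finset.mem_univ k), zero_div]
      simp [Nat.choose_eq_zero_of_lt hk]
  | succ i ih =>
    obtain ⟨n, hn⟩ : ∃ n, N - i = n + 1 := ⟨N - i - 1, by omega⟩
    have hn' : N - (i + 1) = n := by omega
    have hα : ∑ k, (α.1 k : ℝ) = n := by exact_mod_cast α.2.trans hn'
    have hβ : ∑ k, (β.1 k : ℝ) = N := by exact_mod_cast β.2
    have hc : (N.choose (n + 1) : ℝ) * (n + 1) = N.choose n * ((N : ℝ) - n) := by
      rw [← Nat.cast_sub (by omega)]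
      exact_mod_cast Nat.choose_succ_right_eq N n
    have hc0 : (N.choose n : ℝ) ≠ 0 := by
      exact_mod_cast (Nat.choose_pos (by omega)).ne'
    have hc1 : (N.choose (n + 1) : ℝ) ≠ 0 := by
      exact_mod_cast (Nat.choose_pos (by omega)).ne'
    have hn1 : (n : ℝ) + 1 ≠ 0 := by positivity
    change ∑ γ, elevation d N i β γ * elevationStep d (N - i) γ α = _
    simp only [fun γ => ih (by omega) γ]
    rw [sum_mul_elevationStep (by omega)
      (fun γ => (∏ k, ((β.1 k).choose (γ k) : ℝ)) / N.choose (N - i))]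
    have e1 : (N.choose (N - i) : ℝ) = N.choose (n + 1) := by rw [hn]
    have e2 : (N.choose (N - (i + 1)) : ℝ) = N.choose n := by rw [hn']
    have e3 : ((N - i : ℕ) : ℝ) = ((n + 1 : ℕ) : ℝ) := by rw [hn]
    rw [e1, e2, e3]
    have : ∀ j, (∏ k, ((β.1 k).choose ((α.1 + Pi.single j 1 : Fin (d + 1) → ℕ) k) : ℝ)) /
        N.choose (n + 1) * (((α.1 j : ℝ) + 1) / ((n + 1 : ℕ) : ℝ)) =
        (∏ k, ((β.1 k).choose (α.1 k) : ℝ)) / (N.choose (n + 1) * (n + 1)) *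
          ((β.1 j : ℝ) - α.1 j) := by
      intro j
      have := prod_choose_add_single α.1 β.1 j
      push_cast
      field_simp
      linear_combination this
    -- The factors β_j - α_j sum to N - n, which cancels through C(N, n+1)(n+1) = C(N, n)(N - n).
    rw [Finset.sum_congr rfl fun j _ => this j, ← Finset.mul_sum, Finset.sum_sub_distrib, hα, hβ,
      hc]
    have hNn : (N : ℝ) - n ≠ 0 := by
      rw [← Nat.cast_sub (by omega)]
      exact_mod_cast (by omega : N - n ≠ 0)
    field_simp

/-! ### The ladder relation -/

theorem add_single_eq_iff {α β : Fin (d + 1) → ℕ} {j k : Fin (d + 1)} (hjk : j ≠ k) :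
    α + Pi.single j 1 = β + Pi.single k 1 → α j + 1 = β j ∧ α k = β k + 1 := by
  intro h
  have h1 := congrFun h j
  have h2 := congrFun h k
  simp [hjk, hjk.symm] at h1 h2
  exact ⟨h1, h2⟩

theorem elevationStep_transpose_mul_apply {n : ℕ} (hn : 1 ≤ n) (α β : MultiIndex d (n - 1)) :
    ((elevationStep d n)ᵀ * elevationStep d n) α β =
      ∑ j, ∑ k, (if α.1 + Pi.single j 1 = β.1 + Pi.single k 1 then
        ((α.1 j : ℝ) + 1) * ((β.1 k : ℝ) + 1) else 0) / (n : ℝ) ^ 2 := by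
  rw [Matrix.mul_apply]
  simp only [Matrix.transpose_apply]
  rw [Finset.sum_congr rfl fun γ _ => mul_comm _ _]
  have := sum_mul_elevationStep hn (fun γ => ∑ k, if γ = β.1 + Pi.single k 1 then
    ((β.1 k : ℝ) + 1) / (n : ℝ) else 0) α
  refine this.trans (Finset.sum_congr rfl fun j _ => ?_)
  rw [Finset.sum_mul]
  refine Finset.sum_congr rfl fun k _ => ?_
  split_ifs <;> ring

/-- The condition α - e_j = β - e_k is written without subtraction, to match the form of EᵀE. Where
α - e_j does not exist, the weight α_j is zero. -/
theorem elevationStep_mul_transpose_apply {n : ℕ} (hn : 1 ≤ n) (α β : MultiIndex d n) :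
    (elevationStep d n * (elevationStep d n)ᵀ) α β =
      ∑ j, ∑ k, (if α.1 + Pi.single k 1 = β.1 + Pi.single j 1 then
        (α.1 j : ℝ) * (β.1 k : ℝ) else 0) / (n : ℝ) ^ 2 := by
  rw [Matrix.mul_apply]
  simp only [Matrix.transpose_apply, elevationStep, Matrix.of_apply, Finset.sum_mul_sum]
  rw [Finset.sum_comm]
  refine Finset.sum_congr rfl fun j _ => ?_
  rw [Finset.sum_comm]
  refine Finset.sum_congr rfl fun k _ => ?_
  by_cases hj : α.1 j = 0
  · rw [Finset.sum_eq_zero]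
    · simp [hj]
    · intro γ _
      rw [if_neg, zero_mul]
      intro h
      have := congrFun h j
      simp [hj] at this
  obtain ⟨γ, hγ⟩ : ∃ γ : Fin (d + 1) → ℕ, α.1 = γ + Pi.single j 1 := by
    refine ⟨α.1 - Pi.single j 1, funext fun l => ?_⟩
    rcases eq_or_ne l j with rfl | h
    · simp; omega
    · simp [h]
  have hγs : ∑ l, γ l = n - 1 := by
    have := sum_add_single γ j
    rw [← hγ, α.2] at this
    omega
  rw [Finset.sum_eq_single (⟨γ, hγs⟩ : MultiIndex d (n - 1))]
  · have e : (α.1 + Pi.single k 1 = β.1 + Pi.single j 1) ↔ β.1 = γ + Pi.single k 1 := by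
      rw [hγ, add_right_comm, add_left_inj, eq_comm]
    simp only [e]
    rw [if_pos hγ]
    split_ifs with h
    · rw [h, hγ]; simp; ring
    · simp
  · intro δ _ hδ
    rw [if_neg, zero_mul]
    rw [hγ, add_left_inj]
    exact fun h => hδ (Subtype.ext h.symm)
  · simp

/-- The commutation relation between degree elevation and its transpose. -/
theorem elevationStep_transpose_mul_self (d n : ℕ) :
    (elevationStep d (n + 1))ᵀ * elevationStep d (n + 1) =
      ((n : ℝ) ^ 2 / ((n : ℝ) + 1) ^ 2) • (elevationStep d n * (elevationStep d n)ᵀ) +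
        ((2 * (n : ℝ) + d + 1) / ((n : ℝ) + 1) ^ 2) •
          (1 : Matrix (MultiIndex d n) (MultiIndex d n) ℝ) := by
  refine Matrix.ext fun (α β : MultiIndex d n) => ?_
  have hn1 : (n : ℝ) + 1 ≠ 0 := by positivity
  have hα : ∑ k, (α.1 k : ℝ) = n := by exact_mod_cast α.2
  have hL := elevationStep_transpose_mul_apply (Nat.le_add_left 1 n) α β
  have hR : (n : ℝ) ^ 2 * (elevationStep d n * (elevationStep d n)ᵀ) α β =
      ∑ j, ∑ k, (if α.1 + Pi.single k 1 = β.1 + Pi.single j 1 then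
        (α.1 j : ℝ) * (β.1 k : ℝ) else 0) := by
    rcases Nat.eq_zero_or_pos n with rfl | hn
    · have h0 : ∀ j, α.1 j = 0 := fun j => (Finset.sum_eq_zero_iff.1 α.2) j (Finset.mem_univ j)
      simp [h0]
    · have : (n : ℝ) ≠ 0 := by positivity
      rw [elevationStep_mul_transpose_apply hn]
      simp only [← Finset.sum_div]
      field_simp
  have hD : ∑ j, ∑ k, (if α.1 + Pi.single j 1 = β.1 + Pi.single k 1 then
        ((α.1 j : ℝ) + 1) * ((β.1 k : ℝ) + 1) else 0) =
      ∑ j, ∑ k, (if α.1 + Pi.single k 1 = β.1 + Pi.single j 1 then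
        (α.1 j : ℝ) * (β.1 k : ℝ) else 0) +
      (2 * (n : ℝ) + d + 1) * (1 : Matrix (MultiIndex d n) (MultiIndex d n) ℝ) α β := by
    -- The scalar is the diagonal surplus: (α_j + 1)² - α_j² = 2α_j + 1, summed over the d + 1
    -- indices.
    have h1 : (2 * (n : ℝ) + d + 1) * (1 : Matrix (MultiIndex d n) (MultiIndex d n) ℝ) α β =
        ∑ j, ∑ k, if j = k then (if α.1 = β.1 then 2 * (α.1 j : ℝ) + 1 else 0) else 0 := by
      simp only [Finset.sum_ite_eq, Finset.mem_univ, if_true, Matrix.one_apply,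
        Subtype.ext_iff]
      split_ifs
      · rw [Finset.sum_add_distrib, ← Finset.mul_sum, hα]
        simp
        ring
      · simp
    rw [h1, Finset.sum_comm, ← Finset.sum_add_distrib]
    refine Finset.sum_congr rfl fun j _ => ?_
    rw [← Finset.sum_add_distrib]
    refine Finset.sum_congr rfl fun k _ => ?_
    rcases eq_or_ne j k with rfl | hjk
    · simp only [add_left_inj, if_true]
      split_ifs with h
      · rw [h]; ring
      · simp
    · rw [if_neg hjk, add_zero]
      split_ifs with h
      -- Off the diagonal, α_k + 1 = β_k and α_j = β_j + 1, so the two weights coincide.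
      · obtain ⟨h1, h2⟩ := add_single_eq_iff hjk.symm h
        rw [← h1, h2]
        push_cast
        ring
      · rfl
  simp only [Matrix.add_apply, Matrix.smul_apply, smul_eq_mul]
  refine hL.trans ?_
  simp only [← Finset.sum_div]
  rw [hD, ← hR]
  push_cast
  field_simp

/-! ### The algebra spanned by the matrices G_j -/

/-- The symmetric matrix `E^N_{N-j} (E^N_{N-j})ᵀ`. -/
def elevationGram (d N j : ℕ) : Matrix (MultiIndex d N) (MultiIndex d N) ℝ :=
  elevation d N j * (elevation d N j)ᵀ

theorem elevationGram_zero (d N : ℕ) : elevationGram d N 0 = 1 := by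
  change (1 : Matrix (MultiIndex d N) (MultiIndex d N) ℝ) * 1ᵀ = 1
  simp

theorem elevationGram_one (d N : ℕ) :
    elevationGram d N 1 = elevationStep d N * (elevationStep d N)ᵀ := by
  change ((1 : Matrix (MultiIndex d N) (MultiIndex d N) ℝ) * elevationStep d N) *
    ((1 : Matrix (MultiIndex d N) (MultiIndex d N) ℝ) * elevationStep d N)ᵀ = _
  rw [Matrix.one_mul]

theorem elevationGram_succ (d N j : ℕ) :
    elevationGram d N (j + 1) = elevation d N j *
      (elevationStep d (N - j) * (elevationStep d (N - j))ᵀ) * (elevation d N j)ᵀ := by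
  change (elevation d N j * elevationStep d (N - j)) *
    (elevation d N j * elevationStep d (N - j))ᵀ = _
  rw [Matrix.transpose_mul]
  simp only [Matrix.mul_assoc]

theorem elevationGram_self_add_one (d N : ℕ) : elevationGram d N (N + 1) = 0 := by
  have h : ∀ m, m = 0 → elevationStep d m * (elevationStep d m)ᵀ = 0 := by
    rintro _ rfl
    simp [elevationStep_zero]
  rw [elevationGram_succ, h _ (Nat.sub_self N), Matrix.mul_zero, Matrix.zero_mul]

/-- The ladder relation moves EEᵀ past one elevation step at a time. Passing from degree n + 1 to n
multiplies p by n²/(n+1)², which is nonzero until degree 0 is reached. -/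
theorem exists_elevationStep_mul_elevation (d N j : ℕ) (hj : j ≤ N) :
    ∃ p q : ℝ, (j < N → p ≠ 0) ∧
      elevationStep d N * (elevationStep d N)ᵀ * elevation d N j =
        elevation d N j * (p • (elevationStep d (N - j) * (elevationStep d (N - j))ᵀ) + q • 1) := by
  induction j with
  | zero =>
    refine ⟨1, 0, by simp, ?_⟩
    change elevationStep d N * (elevationStep d N)ᵀ *
      (1 : Matrix (MultiIndex d N) (MultiIndex d N) ℝ) =
      (1 : Matrix (MultiIndex d N) (MultiIndex d N) ℝ) *
        ((1 : ℝ) • (elevationStep d N * (elevationStep d N)ᵀ) + (0 : ℝ) • 1)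
    simp
  | succ j ih =>
    obtain ⟨p, q, hp, h⟩ := ih (by omega)
    -- The degree is a free variable here so that it can be replaced by n + 1 inside the matrix
    -- types.
    have key : ∀ m, m ≠ 0 → ∃ p' q' : ℝ, (m - 1 ≠ 0 → p' ≠ 0) ∧
        (p • (elevationStep d m * (elevationStep d m)ᵀ) + q • 1) * elevationStep d m =
        elevationStep d m *
          (p' • (elevationStep d (m - 1) * (elevationStep d (m - 1))ᵀ) + q' • 1) := by
      intro m hm
      obtain ⟨n, rfl⟩ := Nat.exists_eq_succ_of_ne_zero hm
      have hc := elevationStep_transpose_mul_self d n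
      refine ⟨p * ((n : ℝ) ^ 2 / ((n : ℝ) + 1) ^ 2),
        p * ((2 * (n : ℝ) + d + 1) / ((n : ℝ) + 1) ^ 2) + q, fun hn => ?_, ?_⟩
      · have hn' : (n : ℝ) ≠ 0 := by exact_mod_cast hn
        have := hp (by omega)
        positivity
      · change _ = elevationStep d (n + 1) *
          (_ • (elevationStep d n * (elevationStep d n)ᵀ) +
            _ • (1 : Matrix (MultiIndex d n) (MultiIndex d n) ℝ))
        rw [add_smul, mul_smul, mul_smul, ← add_assoc, ← smul_add, ← hc]
        rw [Matrix.add_mul, Matrix.smul_mul, Matrix.mul_add, Matrix.mul_smul, Matrix.mul_assoc,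
          Matrix.smul_mul, Matrix.one_mul, Matrix.mul_smul]
        congr 2
        exact (Matrix.mul_one _).symm
    obtain ⟨p', q', hp', h'⟩ := key (N - j) (by omega)
    refine ⟨p', q', fun hlt => hp' (by omega), ?_⟩
    change elevationStep d N * (elevationStep d N)ᵀ * (elevation d N j * elevationStep d (N - j)) =
      elevation d N j * elevationStep d (N - j) * _
    rw [← Matrix.mul_assoc, h, Matrix.mul_assoc, h', ← Matrix.mul_assoc]
    rfl

theorem exists_elevationGram_one_mul (d N j : ℕ) (hj : j ≤ N) :
    ∃ p q : ℝ, (j < N → p ≠ 0) ∧ elevationGram d N 1 * elevationGram d N j =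
      p • elevationGram d N (j + 1) + q • elevationGram d N j := by
  obtain ⟨p, q, hp, h⟩ := exists_elevationStep_mul_elevation d N j hj
  refine ⟨p, q, hp, ?_⟩
  rw [elevationGram_one, elevationGram_succ]
  simp only [elevationGram]
  rw [← Matrix.mul_assoc, h, Matrix.mul_add, Matrix.add_mul, Matrix.mul_smul, Matrix.smul_mul,
    Matrix.mul_smul, Matrix.smul_mul, Matrix.mul_one]

/-- Since p ≠ 0 for j < N, the recurrence can be solved for G_{j+1}. -/
theorem elevationGram_mem_adjoin (d N j : ℕ) (hj : j ≤ N) :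
    elevationGram d N j ∈ Algebra.adjoin ℝ {elevationGram d N 1} := by
  have h1 : elevationGram d N 1 ∈ Algebra.adjoin ℝ {elevationGram d N 1} :=
    Algebra.self_mem_adjoin_singleton ℝ _
  induction j with
  | zero => rw [elevationGram_zero]; exact one_mem _
  | succ j ih =>
    obtain ⟨p, q, hp, h⟩ := exists_elevationGram_one_mul d N j (by omega)
    have hS := ih (by omega)
    have : elevationGram d N (j + 1) = p⁻¹ •
        (elevationGram d N 1 * elevationGram d N j - q • elevationGram d N j) := by
      rw [h, add_sub_cancel_right, inv_smul_smul₀ (hp (by omega))]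
    rw [this]
    exact Subalgebra.smul_mem _ (sub_mem (mul_mem h1 hS) (Subalgebra.smul_mem _ hS _)) _

/-- The span contains 1 = G_0 and is stable under multiplication by G_1, because G_{N+1} = 0; hence
it contains every polynomial in G_1. -/
theorem adjoin_le_span_elevationGram (d N : ℕ) {A : Matrix (MultiIndex d N) (MultiIndex d N) ℝ}
    (hA : A ∈ Algebra.adjoin ℝ {elevationGram d N 1}) :
    A ∈ Submodule.span ℝ (Set.range fun j : Fin (N + 1) => elevationGram d N j) := by
  set W := Submodule.span ℝ (Set.range fun j : Fin (N + 1) => elevationGram d N j) with hW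
  have hmem : ∀ j ≤ N, elevationGram d N j ∈ W := fun j hj =>
    Submodule.subset_span ⟨⟨j, by omega⟩, rfl⟩
  have hmul : ∀ B ∈ W, elevationGram d N 1 * B ∈ W := by
    intro B hB
    induction hB using Submodule.span_induction with
    | mem x hx =>
      obtain ⟨j, rfl⟩ := hx
      have hj : (j : ℕ) ≤ N := by omega
      obtain ⟨p, q, -, h⟩ := exists_elevationGram_one_mul d N j hj
      simp only [h]
      refine W.add_mem (W.smul_mem _ ?_) (W.smul_mem _ (hmem j hj))
      rcases hj.lt_or_eq with hlt | heq
      · exact hmem _ hlt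
      · rw [heq, elevationGram_self_add_one]
        exact W.zero_mem
    | zero => rw [Matrix.mul_zero]; exact W.zero_mem
    | add x y _ _ hx hy => rw [Matrix.mul_add]; exact W.add_mem hx hy
    | smul a x _ hx => rw [Matrix.mul_smul]; exact W.smul_mem _ hx
  have hpow : ∀ n, elevationGram d N 1 ^ n ∈ W := by
    intro n
    induction n with
    | zero => rw [pow_zero, ← elevationGram_zero]; exact hmem 0 (Nat.zero_le _)
    | succ n ih => rw [pow_succ']; exact hmul _ ih
  rw [Algebra.adjoin_singleton_eq_range_aeval] at hA
  obtain ⟨p, rfl⟩ := hA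
  change Polynomial.aeval (elevationGram d N 1) p ∈ W
  rw [Polynomial.aeval_eq_sum_range]
  exact W.sum_mem fun n _ => W.smul_mem _ (hpow n)

/-- Left multiplication by A is injective on the finite-dimensional space S, hence surjective, so it
attains 1. -/
theorem inv_mem_subalgebra_of_isUnit_det {n K : Type*} [Fintype n] [DecidableEq n] [Field K]
    (S : Subalgebra K (Matrix n n K)) {A : Matrix n n K} (hA : A ∈ S) (hu : IsUnit A.det) :
    A⁻¹ ∈ S := by
  let f : S →ₗ[K] S := LinearMap.mulLeft K (⟨A, hA⟩ : S)
  have hinj : Function.Injective f := by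
    intro X Y h
    have h' : A * X.1 = A * Y.1 := congrArg Subtype.val h
    have := congrArg (A⁻¹ * ·) h'
    simp only [← Matrix.mul_assoc, Matrix.nonsing_inv_mul A hu, Matrix.one_mul] at this
    exact Subtype.ext this
  obtain ⟨X, hX⟩ := (LinearMap.injective_iff_surjective.1 hinj) 1
  have h' : A * X.1 = 1 := congrArg Subtype.val hX
  rw [Matrix.inv_eq_right_inv h']
  exact X.2

/-! ### Vandermonde's identity and positive definiteness -/

/-- Vandermonde's identity over all multi-indices of order at most `N`. -/
theorem sum_prod_choose_mul_prod_choose {N : ℕ} (α β : MultiIndex d N) :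
    ∑ m ∈ Finset.range (N + 1), ∑ γ : MultiIndex d m,
      (∏ k, ((α.1 k).choose (γ.1 k) : ℝ)) * ∏ k, ((β.1 k).choose (γ.1 k) : ℝ) =
    ∏ k, ((α.1 k + β.1 k).choose (α.1 k) : ℝ) := by
  have hV : ∀ a b : ℕ, ((a + b).choose a : ℝ) =
      ∑ i ∈ Finset.range (a + 1), (a.choose i : ℝ) * b.choose i := by
    intro a b
    rw [add_comm, Nat.add_choose_eq, Finset.Nat.sum_antidiagonal_eq_sum_range_succ_mk]
    push_cast
    refine Finset.sum_congr rfl fun i hi => ?_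
    rw [Nat.choose_symm (by simpa [Nat.lt_succ_iff] using hi), mul_comm]
  simp only [hV]
  rw [Finset.prod_univ_sum]
  have hle : ∀ γ ∈ Fintype.piFinset fun k => Finset.range (α.1 k + 1),
      ∑ k, γ k ∈ Finset.range (N + 1) := by
    intro γ hγ
    rw [Finset.mem_range, Nat.lt_succ_iff, ← α.2]
    exact Finset.sum_le_sum fun k _ => by
      simpa [Nat.lt_succ_iff] using Fintype.mem_piFinset.1 hγ k
  -- The terms are grouped by the order m of γ. Allowing every γ of order m adds only zero terms,
  -- those with some γ_k > α_k.
  rw [← Finset.sum_fiberwise_of_maps_to hle]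
  refine Finset.sum_congr rfl fun m _ => ?_
  simp only [← Finset.prod_mul_distrib]
  refine Eq.symm (Eq.trans ?_ (Finset.sum_subtype (Finset.Nat.antidiagonalTuple (d + 1) m)
    (fun _ => Finset.Nat.mem_antidiagonalTuple)
    (fun γ => ∏ k, ((α.1 k).choose (γ k) : ℝ) * (β.1 k).choose (γ k))))
  refine Finset.sum_subset ?_ ?_
  · intro γ hγ
    exact Finset.Nat.mem_antidiagonalTuple.2 (Finset.mem_filter.1 hγ).2
  · intro γ hγ hγ'
    have hs := Finset.Nat.mem_antidiagonalTuple.1 hγ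
    obtain ⟨k, hk⟩ : ∃ k, α.1 k < γ k := by
      by_contra! hle
      exact hγ' (Finset.mem_filter.2 ⟨Fintype.mem_piFinset.2 fun k => by
        simpa [Nat.lt_succ_iff] using hle k, hs⟩)
    exact Finset.prod_eq_zero (Finset.mem_univ k) (by simp [Nat.choose_eq_zero_of_lt hk])

/-- The weights cancel the denominators C(N, N-j) of the two elevation factors, leaving the
Vandermonde sum with m = N - j. -/
theorem sum_choose_sq_smul_elevationGram_apply {N : ℕ} (α β : MultiIndex d N) :
    (∑ j ∈ Finset.range (N + 1), (N.choose (N - j) : ℝ) ^ 2 • elevationGram d N j) α β =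
      ∏ k, ((α.1 k + β.1 k).choose (α.1 k) : ℝ) := by
  rw [← sum_prod_choose_mul_prod_choose, Matrix.sum_apply]
  refine Eq.trans ?_ (Finset.sum_range_reflect _ (N + 1))
  refine Finset.sum_congr rfl fun j hj => ?_
  have hj : j ≤ N := by simpa [Nat.lt_succ_iff] using hj
  have hc : (N.choose (N - j) : ℝ) ≠ 0 := by
    exact_mod_cast (Nat.choose_pos (by omega)).ne'
  change _ = ∑ γ : MultiIndex d (N - j),
    (∏ k, ((α.1 k).choose (γ.1 k) : ℝ)) * ∏ k, ((β.1 k).choose (γ.1 k) : ℝ)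
  simp only [Matrix.smul_apply, elevationGram, Matrix.mul_apply, Matrix.transpose_apply,
    elevation_apply N j hj, smul_eq_mul, Finset.mul_sum]
  refine Finset.sum_congr rfl fun γ _ => ?_
  field_simp

/-- The term j = 0 is the identity; all others are positive semidefinite. -/
theorem posDef_sum_choose_sq_smul_elevationGram (d N : ℕ) :
    (∑ j ∈ Finset.range (N + 1), (N.choose (N - j) : ℝ) ^ 2 • elevationGram d N j).PosDef := by
  rw [Finset.sum_range_succ', elevationGram_zero]
  refine Matrix.PosDef.posSemidef_add ?_ ?_
  · refine Matrix.posSemidef_sum _ fun j _ => Matrix.PosSemidef.smul ?_ (by positivity)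
    exact Matrix.posSemidef_self_mul_conjTranspose (elevation d N (j + 1))
  · simpa using Matrix.PosDef.one

/-! ### Dirichlet's integral over the simplex -/

theorem integral_pow_mul_sub_pow (s : ℝ) (a b : ℕ) :
    ∫ y in (0 : ℝ)..s, y ^ a * (s - y) ^ b =
      (a ! : ℝ) * b ! / (a + b + 1)! * s ^ (a + b + 1) := by
  induction b generalizing a with
  | zero =>
    simp [integral_pow, Nat.factorial_succ]
    field_simp
  | succ b ih =>
    -- Integration by parts: y^(a+1) (s-y)^(b+1) vanishes at both ends, which trades a power of s -
    -- y for one of y.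
    have hd : ∀ y ∈ Set.uIcc 0 s, HasDerivAt (fun y : ℝ => y ^ (a + 1) * (s - y) ^ (b + 1))
        (((a : ℝ) + 1) * (y ^ a * (s - y) ^ (b + 1)) -
          ((b : ℝ) + 1) * (y ^ (a + 1) * (s - y) ^ b)) y := by
      intro y _
      have h1 := hasDerivAt_pow (a + 1) y
      have h2 := ((hasDerivAt_id y).const_sub s).pow (b + 1)
      refine (h1.mul h2).congr_deriv ?_
      simp
      ring
    have hi : ∀ p q : ℕ, IntervalIntegrable (fun y : ℝ => y ^ p * (s - y) ^ q) volume 0 s :=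
      fun p q => (by fun_prop : Continuous fun y : ℝ => y ^ p * (s - y) ^ q).intervalIntegrable _ _
    have h := intervalIntegral.integral_eq_sub_of_hasDerivAt hd
      (((hi _ _).const_mul _).sub ((hi _ _).const_mul _))
    rw [intervalIntegral.integral_sub ((hi _ _).const_mul _) ((hi _ _).const_mul _),
      intervalIntegral.integral_const_mul, intervalIntegral.integral_const_mul, ih (a + 1)] at h
    have e : a + 1 + b + 1 = a + (b + 1) + 1 := by ring
    rw [e] at h
    have ha : (a : ℝ) + 1 ≠ 0 := by positivity
    simp only [sub_self, ne_eq, Nat.add_eq_zero_iff, one_ne_zero, and_false, not_false_eq_true,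
      zero_pow, mul_zero, zero_mul] at h
    rw [Nat.factorial_succ a] at h
    rw [Nat.factorial_succ b]
    push_cast at h ⊢
    apply mul_left_cancel₀ ha
    rw [sub_eq_zero.1 h]
    ring

theorem integral_affine_pow_mul_sub_pow (s : ℝ) (a b : ℕ) :
    ∫ x in (-1 : ℝ)..(2 * s - 1), ((1 + x) / 2) ^ a * (s - (1 + x) / 2) ^ b =
      2 * ((a ! : ℝ) * b ! / (a + b + 1)! * s ^ (a + b + 1)) := by
  have h := intervalIntegral.integral_comp_div_add (a := -1) (b := 2 * s - 1)
    (fun y : ℝ => y ^ a * (s - y) ^ b) (two_ne_zero) (1 / 2)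
  have e1 : (-1 : ℝ) / 2 + 1 / 2 = 0 := by norm_num
  have e2 : (2 * s - 1) / 2 + 1 / 2 = s := by ring
  rw [e1, e2, integral_pow_mul_sub_pow, smul_eq_mul] at h
  rw [← h]
  congr 1
  ext x
  ring_nf

/-- The Dirichlet integrand on the simplex of size `s`, extended by zero. -/
def dirichletDensity (d : ℕ) (γ : Fin d → ℕ) (b : ℕ) (s : ℝ) (x : Fin d → ℝ) : ℝ≥0∞ :=
  if (∀ i, -1 ≤ x i) ∧ ∑ i, (1 + x i) / 2 ≤ s then
    ENNReal.ofReal ((∏ i, ((1 + x i) / 2) ^ γ i) * (s - ∑ i, (1 + x i) / 2) ^ b) else 0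

theorem measurable_dirichletDensity (d : ℕ) (γ : Fin d → ℕ) (b : ℕ) (s : ℝ) :
    Measurable (dirichletDensity d γ b s) := by
  refine Measurable.ite ?_ (by fun_prop) measurable_const
  refine IsClosed.measurableSet ?_
  have h : IsClosed (⋂ i, {x : Fin d → ℝ | -1 ≤ x i}) :=
    isClosed_iInter fun i => isClosed_le continuous_const (continuous_apply i)
  rw [← Set.ofPred_forall] at h
  have h' : IsClosed {x : Fin d → ℝ | ∑ i, (1 + x i) / 2 ≤ s} :=
    isClosed_le (by fun_prop) continuous_const
  exact h.inter h'

theorem dirichletDensity_of_neg (γ : Fin d → ℕ) (b : ℕ) {s : ℝ} (hs : s < 0) (x : Fin d → ℝ) :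
    dirichletDensity d γ b s x = 0 := by
  refine if_neg fun h => ?_
  have : 0 ≤ ∑ i, (1 + x i) / 2 := Finset.sum_nonneg fun i _ => by linarith [h.1 i]
  linarith [h.2]

theorem dirichletDensity_cons (γ : Fin (d + 1) → ℕ) (b : ℕ) (s : ℝ) (y : ℝ) (x : Fin d → ℝ) :
    dirichletDensity (d + 1) γ b s (Fin.cons y x) =
      if -1 ≤ y then ENNReal.ofReal (((1 + y) / 2) ^ γ 0) *
        dirichletDensity d (fun i => γ i.succ) b (s - (1 + y) / 2) x else 0 := by
  simp only [dirichletDensity, Fin.forall_fin_succ, Fin.sum_univ_succ, Fin.prod_univ_succ,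
    Fin.cons_zero, Fin.cons_succ]
  by_cases hy : -1 ≤ y
  · simp only [hy, true_and, if_true, le_sub_iff_add_le', mul_ite, mul_zero]
    split_ifs with h
    · rw [← ENNReal.ofReal_mul (pow_nonneg (by linarith) _)]
      congr 1
      ring
    · rfl
  · simp [hy]

/-- Fixing the first coordinate y leaves the same density in one dimension less, on a simplex of
size s - (1+y)/2; hence the induction with s free. The remaining integral over y is a Beta integral.
-/
theorem lintegral_dirichletDensity (γ : Fin d → ℕ) (b : ℕ) {s : ℝ} (hs : 0 ≤ s) :
    ∫⁻ x, dirichletDensity d γ b s x =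
      ENNReal.ofReal (2 ^ d * ((b ! : ℝ) * ∏ i, ((γ i)! : ℝ)) / (b + ∑ i, γ i + d)! *
        s ^ (b + ∑ i, γ i + d)) := by
  induction d generalizing s with
  | zero =>
    rw [Measure.volume_pi_eq_dirac (0 : Fin 0 → ℝ), lintegral_dirac]
    simp only [dirichletDensity]
    have : (b ! : ℝ) ≠ 0 := by positivity
    simp [hs, this]
  | succ d ih =>
    set m := b + ∑ i : Fin d, γ i.succ + d with hm
    set C : ℝ := 2 ^ d * ((b ! : ℝ) * ∏ i : Fin d, ((γ i.succ)! : ℝ)) / m ! with hC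
    have hmp := (volume_preserving_piFinSuccAbove (fun _ : Fin (d + 1) => ℝ) 0).symm
    rw [← hmp.lintegral_comp (measurable_dirichletDensity _ _ _ _)]
    rw [Measure.volume_eq_prod, lintegral_prod (fun z => dirichletDensity (d + 1) γ b s
      ((MeasurableEquiv.piFinSuccAbove (fun _ : Fin (d + 1) => ℝ) 0).symm z))
      ((measurable_dirichletDensity _ _ _ _).comp (MeasurableEquiv.measurable _)).aemeasurable]
    have hinner : ∀ y : ℝ, ∫⁻ x : Fin d → ℝ, dirichletDensity (d + 1) γ b s
        ((MeasurableEquiv.piFinSuccAbove (fun _ : Fin (d + 1) => ℝ) 0).symm (y, x)) =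
        (Set.Icc (-1) (2 * s - 1)).indicator (fun y => ENNReal.ofReal
          (C * (((1 + y) / 2) ^ γ 0 * (s - (1 + y) / 2) ^ m))) y := by
      intro y
      have hcons : ∀ x : Fin d → ℝ,
          (MeasurableEquiv.piFinSuccAbove (fun _ : Fin (d + 1) => ℝ) 0).symm (y, x) =
            (Fin.cons y x : Fin (d + 1) → ℝ) := fun x => by
        simp [MeasurableEquiv.piFinSuccAbove, Fin.consEquiv]
      simp only [hcons, dirichletDensity_cons]
      by_cases hy : -1 ≤ y
      · simp only [hy, if_true]
        rw [lintegral_const_mul _ (measurable_dirichletDensity _ _ _ _)]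
        by_cases hy' : y ≤ 2 * s - 1
        · rw [ih _ (by linarith : 0 ≤ s - (1 + y) / 2), Set.indicator_of_mem (Set.mem_Icc.2 ⟨hy, hy'⟩),
            ← ENNReal.ofReal_mul (pow_nonneg (by linarith) _)]
          congr 1
          rw [← hm, ← hC]
          ring
        · rw [Set.indicator_of_notMem fun h => hy' h.2]
          simp [fun x => dirichletDensity_of_neg (fun i => γ i.succ) b
            (by linarith : s - (1 + y) / 2 < 0) x]
      · rw [Set.indicator_of_notMem fun h => hy h.1]
        simp [hy]
    simp only [hinner]
    rw [lintegral_indicator measurableSet_Icc, ← ofReal_integral_eq_lintegral_ofReal]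
    · congr 1
      rw [integral_Icc_eq_integral_Ioc,
        ← intervalIntegral.integral_of_le (by linarith : (-1 : ℝ) ≤ 2 * s - 1),
        intervalIntegral.integral_const_mul, integral_affine_pow_mul_sub_pow]
      have e : b + ∑ i, γ i + (d + 1) = γ 0 + m + 1 := by
        rw [Fin.sum_univ_succ, hm]; ring
      rw [e, Fin.prod_univ_succ, hC]
      field_simp
      ring
    · exact (Continuous.continuousOn (by fun_prop)).integrableOn_compact isCompact_Icc
    · refine (ae_restrict_iff' measurableSet_Icc).2 (Filter.Eventually.of_forall fun y hy => ?_)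
      have h1 : 0 ≤ (1 + y) / 2 := by linarith [hy.1]
      have h2 : 0 ≤ s - (1 + y) / 2 := by linarith [hy.2]
      positivity

theorem refSimplex_eq (d : ℕ) :
    refSimplex d = {x | (∀ i, -1 ≤ x i) ∧ ∑ i, (1 + x i) / 2 ≤ 1} := by
  ext x
  refine and_congr_right fun _ => ?_
  rw [← Finset.sum_div, Finset.sum_add_distrib]
  simp only [Finset.sum_const, Finset.card_univ, Fintype.card_fin, nsmul_eq_mul, mul_one]
  constructor <;> intro h <;> linarith

theorem bary_zero (x : Fin d → ℝ) : bary d x 0 = 1 - ∑ i, (1 + x i) / 2 := by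
  have h := sum_bary d x
  rw [Fin.sum_univ_succ] at h
  simp only [bary, Fin.cons_zero, Fin.cons_succ] at h ⊢
  linarith

theorem bary_nonneg {x : Fin d → ℝ} (hx : x ∈ refSimplex d) (j : Fin (d + 1)) :
    0 ≤ bary d x j := by
  rw [refSimplex_eq] at hx
  refine Fin.cases ?_ (fun i => ?_) j
  · rw [bary_zero]; linarith [hx.2]
  · simp only [bary, Fin.cons_succ]; linarith [hx.1 i]

theorem continuous_bary (j : Fin (d + 1)) : Continuous fun x => bary d x j := by
  refine Fin.cases ?_ (fun i => ?_) j
  · simp only [bary_zero]; fun_prop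
  · simp only [bary, Fin.cons_succ]; fun_prop

theorem measurableSet_refSimplex (d : ℕ) : MeasurableSet (refSimplex d) := by
  refine IsClosed.measurableSet ?_
  have h : IsClosed (⋂ i, {x : Fin d → ℝ | -1 ≤ x i}) :=
    isClosed_iInter fun i => isClosed_le continuous_const (continuous_apply i)
  rw [← Set.ofPred_forall] at h
  have h' : IsClosed {x : Fin d → ℝ | ∑ i, x i ≤ 2 - (d : ℝ)} :=
    isClosed_le (by fun_prop) continuous_const
  exact h.inter h'

/-- Dirichlet's integral over the reference simplex. -/
theorem integral_prod_bary_pow (γ : Fin (d + 1) → ℕ) :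
    ∫ x in refSimplex d, ∏ j, bary d x j ^ γ j =
      2 ^ d * (∏ j, ((γ j)! : ℝ)) / (∑ j, γ j + d)! := by
  have hm := measurableSet_refSimplex d
  rw [integral_eq_lintegral_of_nonneg_ae]
  · rw [← lintegral_indicator hm]
    have : ∀ x, (refSimplex d).indicator (fun x => ENNReal.ofReal (∏ j, bary d x j ^ γ j)) x =
        dirichletDensity d (fun i => γ i.succ) (γ 0) 1 x := by
      intro x
      simp only [dirichletDensity, Set.indicator_apply, refSimplex_eq, Set.mem_ofPred_eq,
        Fin.prod_univ_succ, bary_zero]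
      simp only [bary, Fin.cons_succ, mul_comm]
    simp only [this]
    rw [lintegral_dirichletDensity _ _ zero_le_one, ENNReal.toReal_ofReal (by positivity)]
    simp [Fin.sum_univ_succ, Fin.prod_univ_succ]
  · refine (ae_restrict_iff' hm).2 (Filter.Eventually.of_forall fun x hx => ?_)
    exact Finset.prod_nonneg fun j _ => pow_nonneg (bary_nonneg hx j) _
  · exact (continuous_finsetProd _ fun j _ => (continuous_bary j).pow _).aestronglyMeasurable

/-! ### The mass matrix -/

/-- The product of two Bernstein polynomials is a multiple of the monomial with exponent α + β.
Dirichlet's factorials (α_k + β_k)! then combine with the multinomial denominators into binomials.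
-/
theorem massMatrix_apply {N : ℕ} (α β : MultiIndex d N) :
    massMatrix d N α β = (2 ^ d * (N ! : ℝ) ^ 2 / (2 * N + d)!) *
      ∏ k, ((α.1 k + β.1 k).choose (α.1 k) : ℝ) := by
  have h1 : ∀ x, bernstein d N α x * bernstein d N β x =
      ((N ! : ℝ) ^ 2 / ((∏ j, ((α.1 j)! : ℝ)) * ∏ j, ((β.1 j)! : ℝ))) *
        ∏ j, bary d x j ^ (α.1 + β.1) j := by
    intro x
    simp only [bernstein, Pi.add_apply, pow_add, Finset.prod_mul_distrib]
    ring
  have h2 : ∏ k, ((α.1 k + β.1 k).choose (α.1 k) : ℝ) =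
      (∏ k, ((α.1 k + β.1 k)! : ℝ)) / ((∏ j, ((α.1 j)! : ℝ)) * ∏ j, ((β.1 j)! : ℝ)) := by
    rw [← Finset.prod_mul_distrib, ← Finset.prod_div_distrib]
    exact Finset.prod_congr rfl fun k _ => Nat.cast_add_choose ℝ
  have h3 : ∑ j, (α.1 + β.1) j = 2 * N := by
    simp only [Pi.add_apply, Finset.sum_add_distrib, α.2, β.2]
    ring
  change ∫ x in refSimplex d, bernstein d N α x * bernstein d N β x = _
  simp only [h1]
  rw [integral_const_mul, integral_prod_bary_pow, h2, h3]
  simp only [Pi.add_apply]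
  ring

/-- The mass matrix as a combination of the matrices `E^N_{N-j} (E^N_{N-j})ᵀ`. -/
theorem massMatrix_eq_smul_sum_elevationGram (d N : ℕ) :
    massMatrix d N = (2 ^ d * (N ! : ℝ) ^ 2 / (2 * N + d)! : ℝ) •
      ∑ j ∈ Finset.range (N + 1), (N.choose (N - j) : ℝ) ^ 2 • elevationGram d N j := by
  ext α β
  rw [massMatrix_apply, Matrix.smul_apply, sum_choose_sq_smul_elevationGram_apply, smul_eq_mul]

theorem massMatrix_posDef (d N : ℕ) : (massMatrix d N).PosDef := by
  rw [massMatrix_eq_smul_sum_elevationGram]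
  exact (posDef_sum_choose_sq_smul_elevationGram d N).smul (by positivity)

theorem massMatrix_mem_adjoin (d N : ℕ) :
    massMatrix d N ∈ Algebra.adjoin ℝ {elevationGram d N 1} := by
  rw [massMatrix_eq_smul_sum_elevationGram]
  refine Subalgebra.smul_mem _ (sum_mem fun j hj => Subalgebra.smul_mem _ ?_ _) _
  exact elevationGram_mem_adjoin d N j (Nat.lt_succ_iff.1 (Finset.mem_range.1 hj))

end BernsteinMass

end

theorem mainTheorem2 (d N : ℕ) :
    IsUnit (BernsteinMass.massMatrix d N).det ∧
    ∃ c : Fin (N + 1) → ℝ,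
      (BernsteinMass.massMatrix d N)⁻¹ =
        ∑ j : Fin (N + 1),
          c j • (BernsteinMass.elevation d N j * (BernsteinMass.elevation d N j)ᵀ) := by
  have hu : IsUnit (BernsteinMass.massMatrix d N).det :=
    (BernsteinMass.massMatrix_posDef d N).det_pos.ne'.isUnit
  refine ⟨hu, ?_⟩
  have h := BernsteinMass.adjoin_le_span_elevationGram d N
    (BernsteinMass.inv_mem_subalgebra_of_isUnit_det _
      (BernsteinMass.massMatrix_mem_adjoin d N) hu)
  obtain ⟨c, hc⟩ := (Submodule.mem_span_range_iff_exists_fun ℝ).1 h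
  exact ⟨c, hc.symm⟩
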